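/- Theorem 1.1. A weight on $\mathbb Z$ is a map $\omega:\mathbb Z\to[1,\infty)$ with $\omega(m+n)\le\omega(m)\omega(n)$ for all $m,n\in\mathbb Z$. It is admissible if $$\sup_{n\ge 1}\omega(-n)^{-1/n}=1=\inf_{n\ge 1}\omega(n)^{1/n}.$$ For a complex unital Banach algebra $\mathcal A$ and a continuous function $f:\mathbb T\to\mathcal A$ on the unit circle, let $\widehat f(n)=\frac1{2\pi}\int_0^{2\pi}f(e^{it})e^{-int}\,dt$ for $n\in\mathbb Z$. For $0<p\le 1$ we say that $f$ has $p\omega$-ACFS if $f(z)=\sum_{n\in\mathbb Z}\widehat f(n)z^n$ for every $z\in\mathbb T$ and $\sum_{n\in\mathbb Z}\|\widehat f(n)\|^p\omega(n)^p<\infty$. Let $0<p\le 1$, let $\mathcal A$ be a complex unital Banach algebra, let $\omega$ be a weight on $\mathbb Z$, and let $f:\mathbb T\to\mathcal A$ be a continuous function which has $p\omega$-ACFS. If $f(z)$ is left invertible (respectively, right invertible, invertible) in $\mathcal A$ for every $z\in\mathbb T$, then there exist a weight $\nu$ on $\mathbb Z$ and a continuous function $g:\mathbb T\to\mathcal A$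 such that 1. $1\le\nu(n)\le\omega(n)$ for all $n\in\mathbb Z$; 2. $\nu$ is constant if and only if $\omega$ is constant; 3. $g$ has $p\nu$-ACFS; 4. $g$ is a left inverse (respectively, right inverse, two-sided inverse) of $f$, that is, for every $z\in\mathbb T$, $g(z)f(z)=1$ (respectively, $f(z)g(z)=1$; $g(z)f(z)=f(z)g(z)=1$). Moreover, if $\omega$ is admissible, then, under the same assumptions, there is a continuous left inverse (respectively, right inverse, two-sided inverse) $g:\mathbb T\to\mathcal A$ of $f$ which has $p\omega$-ACFS. -/

import Mathlib

namespace WeightedWiener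

open scoped Real

/-- A weight on `ℤ`: a map `ω : ℤ → [1, ∞)` with `ω (m + n) ≤ ω m * ω n` for all `m, n`. -/
structure IsWeight (ω : ℤ → ℝ) : Prop where
  one_le : ∀ n, 1 ≤ ω n
  submul : ∀ m n, ω (m + n) ≤ ω m * ω n

/-- `ρ₁ = sup {ω (-n) ^ (-1/n) : n a positive integer}`.
The supremum is over a nonempty set bounded above by `1` when `ω` is a weight. -/
noncomputable def rho₁ (ω : ℤ → ℝ) : ℝ :=
  sSup {x | ∃ n : ℕ, 0 < n ∧ x = ω (-(n : ℤ)) ^ (-(1 / (n : ℝ)))}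

/-- `ρ₂ = inf {ω n ^ (1/n) : n a positive integer}`.
The infimum is over a nonempty set bounded below by `1` when `ω` is a weight. -/
noncomputable def rho₂ (ω : ℤ → ℝ) : ℝ :=
  sInf {x | ∃ n : ℕ, 0 < n ∧ x = ω (n : ℤ) ^ (1 / (n : ℝ))}

/-- A weight is admissible if `ρ₁ = 1 = ρ₂`. -/
def IsAdmissible (ω : ℤ → ℝ) : Prop :=
  rho₁ ω = 1 ∧ rho₂ ω = 1

/-- The function `ω` on `ℤ` is constant. -/
def IsConst (ω : ℤ → ℝ) : Prop :=
  ∃ c : ℝ, ∀ n, ω n = c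

/-- The circle `ℝ / 2πℤ` has positive length. -/
instance fact_two_pi_pos : Fact (0 < 2 * π) := ⟨Real.two_pi_pos⟩

variable {A : Type*} [NormedRing A] [NormedAlgebra ℂ A]

/-- The `n`-th Fourier coefficient of a continuous function on the unit circle: Mathlib's Fourier
coefficient of the function `t ↦ f (e^{it})` on `ℝ / 2πℤ`. -/
noncomputable def coeff (f : C(Circle, A)) (n : ℤ) : A :=
  fourierCoeff (T := 2 * π) (fun t => f t.toCircle) n

/-- The Fourier coefficients are given by the usual integral. -/
theorem coeff_eq_integral (f : C(Circle, A)) (n : ℤ) :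
    coeff f n = (1 / (2 * π) : ℝ) •
      ∫ t in (0 : ℝ)..(2 * π), Complex.exp (-(Complex.I * n * t)) • f (Circle.exp t) := by
  have h := fourierCoeff_eq_intervalIntegral (T := 2 * π) (fun t => f t.toCircle) n 0
  rw [zero_add] at h
  rw [coeff, h]
  congr 1
  refine intervalIntegral.integral_congr fun t _ => ?_
  have hπ : (π : ℂ) ≠ 0 := by exact_mod_cast Real.pi_ne_zero
  have h1 : (2 * π / (2 * π) * t : ℝ) = t := by field_simp
  simp only [fourier_coe_apply, AddCircle.toCircle_apply_mk, h1]
  congr 2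
  push_cast
  field_simp

/-- `f` has `p`-th power `ω`-absolutely convergent Fourier series: `f` is the sum of its Fourier
series at every point of the circle, and `∑ ‖f̂(n)‖^p ω(n)^p < ∞`. -/
structure HasACFS (p : ℝ) (ω : ℤ → ℝ) (f : C(Circle, A)) : Prop where
  hasSum : ∀ z : Circle, HasSum (fun n : ℤ => (z : ℂ) ^ n • coeff f n) (f z)
  summable : Summable fun n : ℤ => ‖coeff f n‖ ^ p * ω n ^ p

end WeightedWiener

namespace WeightedWiener

open scoped Real ENNReal Topology
open Filter MeasureTheory AddCircle

/-! ### Fourier coefficients of continuous functions and recovery from them. -/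

section

variable {A : Type*} [NormedRing A] [NormedAlgebra ℂ A]

/-! Approximate left inverses of `f z` form convex sets, so pointwise inverses glue to a continuous
`h₀` with `‖1 - h₀ * f‖ < 1/2`. By density (`exists_wnorm_ne_top_near`) replace `h₀` by some `h` of
finite weighted `p`-norm. Then `u = 1 - h * f` has sup norm below 1 and finite `p`-norm, and `g = (∑
u ^ n) * h` is a left inverse; right inverses are symmetric.

It remains to bound the Neumann series in the weighted norm. Split `u = Q + e` with `Q` a
trigonometric polynomial of degree at most `M` and `θ = ‖Q‖ ^ p + wnorm e < 1`. By
`wnorm_pow_mul_le`, `wnorm (u ^ n)` is at most a constant times `θ ^ n` times the `ν ^ p`-mass of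
`[-M n, M n]`. If `ν j` is `O(R ^ |j|)`, that mass is `O(n R ^ (p M n))`, so the series converges
once `R ^ (p M) * θ < 1`. Such an `R > 1` exists and depends only on `u` and `ω`. A small power `ω ^
s` grows this slowly (`exists_slow_weight`), and an admissible `ω` does so itself, so one `g` serves
both conclusions. -/

theorem continuous_comp_toCircle {E : Type*} [TopologicalSpace E] (f : C(Circle, E)) :
    Continuous fun t : AddCircle (2 * π) => f t.toCircle :=
  f.continuous.comp continuous_toCircle

theorem integrable_fourier_smul (f : C(Circle, A)) (n : ℤ) :
    Integrable (fun t : AddCircle (2 * π) => fourier (-n) t • f t.toCircle) haarAddCircle :=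
  ((fourier (-n)).continuous.smul
    (continuous_comp_toCircle f)).integrable_of_hasCompactSupport (HasCompactSupport.of_compactSpace _)

theorem toCircle_surjective (z : Circle) : ∃ t : AddCircle (2 * π), t.toCircle = z := by
  obtain ⟨t, ht⟩ := (homeomorphCircle Real.two_pi_pos.ne').surjective z
  exact ⟨t, by rw [← ht, homeomorphCircle_apply]⟩

theorem norm_coeff_le (f : C(Circle, A)) (n : ℤ) : ‖coeff f n‖ ≤ ‖f‖ := by
  refine (norm_integral_le_of_norm_le_const (C := ‖f‖) (.of_forall fun t => ?_)).trans (by simp)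
  rw [norm_smul, fourier_apply, Circle.norm_coe, one_mul]
  exact f.norm_coe_le_norm _

/-- The `n`-th Fourier coefficient as a continuous linear map. -/
noncomputable def coeffCLM (n : ℤ) : C(Circle, A) →L[ℂ] A :=
  LinearMap.mkContinuous
    { toFun := fun f => coeff f n
      map_add' := fun f g => by
        simp only [coeff, fourierCoeff, ContinuousMap.add_apply, smul_add]
        exact integral_add (integrable_fourier_smul f n) (integrable_fourier_smul g n)
      map_smul' := fun c f => fourierCoeff.const_smul _ c n } 1 fun f => by
    rw [one_mul]; exact norm_coeff_le f n

@[simp]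
theorem coeffCLM_apply (n : ℤ) (f : C(Circle, A)) : coeffCLM n f = coeff f n := rfl

/-- Multiplication of a function on the circle by `z ^ k`. -/
noncomputable def shift (k : ℤ) (f : C(Circle, A)) : C(Circle, A) where
  toFun z := (z : ℂ) ^ k • f z
  continuous_toFun := by
    refine Continuous.smul ?_ f.continuous
    exact continuous_subtype_val.zpow₀ k fun z => Or.inl (Circle.coe_ne_zero z)

@[simp]
theorem shift_apply (k : ℤ) (f : C(Circle, A)) (z : Circle) : shift k f z = (z : ℂ) ^ k • f z := rfl

theorem norm_shift_le (k : ℤ) (f : C(Circle, A)) : ‖shift k f‖ ≤ ‖f‖ := by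
  refine (ContinuousMap.norm_le _ (norm_nonneg f)).2 fun z => ?_
  rw [shift_apply, norm_smul, norm_zpow, Circle.norm_coe, one_zpow, one_mul]
  exact f.norm_coe_le_norm z

theorem mul_shift (k : ℤ) (f g : C(Circle, A)) : f * shift k g = shift k (f * g) := by
  ext z; simp

theorem shift_mul (k : ℤ) (f g : C(Circle, A)) : shift k f * g = shift k (f * g) := by
  ext z; simp

theorem coeff_shift (k : ℤ) (f : C(Circle, A)) (n : ℤ) : coeff (shift k f) n = coeff f (n - k) := by
  simp only [coeff, fourierCoeff, shift_apply, ← smul_assoc]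
  refine integral_congr_ae (.of_forall fun t => ?_)
  simp only
  congr 1
  have h : ((t.toCircle : ℂ)) ^ k = fourier k t := by
    rw [fourier_apply, toCircle_zsmul, Circle.coe_zpow]
  rw [h, smul_eq_mul, ← fourier_add]
  congr 2
  ring

omit [NormedAlgebra ℂ A] in
theorem norm_const_le (a : A) : ‖ContinuousMap.const Circle a‖ ≤ ‖a‖ :=
  (ContinuousMap.norm_le _ (norm_nonneg a)).2 fun _ => le_rfl

theorem coeff_const_mul (a : A) (f : C(Circle, A)) (n : ℤ) :
    coeff (ContinuousMap.const Circle a * f) n = a * coeff f n := by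
  simp only [coeff, fourierCoeff, ContinuousMap.mul_apply, ContinuousMap.const_apply,
    ← mul_smul_comm]
  exact integral_const_mul_of_integrable (integrable_fourier_smul f n)

theorem coeff_const (a : A) (n : ℤ) [CompleteSpace A] :
    coeff (ContinuousMap.const Circle a) n = if n = 0 then a else 0 := by
  have h := fourierCoeff_fourier (T := 2 * π) 0
  have h1 : coeff (ContinuousMap.const Circle a) n =
      fourierCoeff (T := 2 * π) (fourier 0) n • a := by
    simp only [coeff, fourierCoeff, ContinuousMap.const_apply, fourier_zero, smul_eq_mul, mul_one]
    exact integral_smul_const _ _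
  rw [h1, h, Pi.single_apply, ite_smul, one_smul, zero_smul]

variable [CompleteSpace A]

/-- Continuous functionals separate points of `A` and commute with the integral, which reduces the
claim to scalar Fourier series. -/
theorem hasSum_coeff_apply {f : C(Circle, A)} (h : Summable fun n => ‖coeff f n‖) (z : Circle) :
    HasSum (fun n : ℤ => (z : ℂ) ^ n • coeff f n) (f z) := by
  have hs : Summable fun n : ℤ => (z : ℂ) ^ n • coeff f n :=
    Summable.of_norm (by simpa only [norm_smul, norm_zpow, Circle.norm_coe, one_zpow, one_mul] using h)
  convert hs.hasSum
  refine (SeparatingDual.eq_iff_forall_dual_eq (R := ℂ)).2 fun φ => ?_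
  obtain ⟨t, rfl⟩ := toCircle_surjective z
  let g : C(AddCircle (2 * π), ℂ) := ⟨fun t => φ (f t.toCircle), φ.continuous.comp
    (continuous_comp_toCircle f)⟩
  have hg : ∀ n, fourierCoeff g n = φ (coeff f n) := fun n => by
    rw [coeff, fourierCoeff, fourierCoeff, ← φ.integral_comp_comm (integrable_fourier_smul f n)]
    simp [g]
  have hgs : Summable (fourierCoeff g) := by
    simp only [funext hg]
    exact (Summable.of_norm h).mapL φ
  have h1 := has_pointwise_sum_fourier_series_of_summable hgs t
  have h2 := hs.hasSum.mapL φ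
  have h3 : (fun n : ℤ => φ ((t.toCircle : ℂ) ^ n • coeff f n)) =
      fun n => fourierCoeff g n • fourier n t := by
    ext n
    rw [hg, map_smul, smul_eq_mul, smul_eq_mul, mul_comm, fourier_apply, toCircle_zsmul,
      Circle.coe_zpow]
  rw [h3] at h2
  exact h1.unique h2

theorem hasSum_shift_coeff {f : C(Circle, A)} (h : Summable fun n => ‖coeff f n‖) :
    HasSum (fun n : ℤ => shift n (ContinuousMap.const Circle (coeff f n))) f := by
  have hs : Summable fun n : ℤ => shift n (ContinuousMap.const Circle (coeff f n)) :=
    Summable.of_norm_bounded h fun n => (norm_shift_le _ _).trans (norm_const_le _)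
  convert hs.hasSum
  ext z
  have h1 := hs.hasSum.mapL (ContinuousMap.evalCLM ℂ z)
  exact (hasSum_coeff_apply h z).unique h1

end

/-! ### The weighted `p`-norm and its submultiplicativity. -/

section

theorem rpow_sum_le_sum_rpow {ι : Type*} (s : Finset ι) (a : ι → ℝ≥0∞) {p : ℝ} (hp0 : 0 < p)
    (hp1 : p ≤ 1) : (∑ i ∈ s, a i) ^ p ≤ ∑ i ∈ s, a i ^ p := by
  classical
  induction s using Finset.induction_on with
  | empty => simp [hp0]
  | insert i s hi ih =>
    rw [Finset.sum_insert hi, Finset.sum_insert hi]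
    exact (ENNReal.rpow_add_le_add_rpow _ _ hp0.le hp1).trans (by gcongr)

theorem rpow_tsum_le_tsum_rpow {ι : Type*} (a : ι → ℝ≥0∞) {p : ℝ} (hp0 : 0 < p) (hp1 : p ≤ 1) :
    (∑' i, a i) ^ p ≤ ∑' i, a i ^ p :=
  le_of_tendsto (ENNReal.continuous_rpow_const.continuousAt.tendsto.comp
    ENNReal.summable.hasSum) (.of_forall fun s =>
      (rpow_sum_le_sum_rpow s a hp0 hp1).trans (ENNReal.sum_le_tsum s))

theorem enorm_mul_le' {B : Type*} [NormedRing B] (a b : B) : ‖a * b‖ₑ ≤ ‖a‖ₑ * ‖b‖ₑ := by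
  rw [← ofReal_norm, ← ofReal_norm, ← ofReal_norm, ← ENNReal.ofReal_mul (norm_nonneg _)]
  exact ENNReal.ofReal_le_ofReal (norm_mul_le _ _)

variable {A : Type*} [NormedRing A] [NormedAlgebra ℂ A]

/-- The `p`-norm `∑ ‖f̂(n)‖^p ν(n)^p`, possibly infinite. -/
noncomputable def wnorm (p : ℝ) (ν : ℤ → ℝ) (f : C(Circle, A)) : ℝ≥0∞ :=
  ∑' n, ‖coeff f n‖ₑ ^ p * ENNReal.ofReal (ν n) ^ p

variable {p : ℝ} {ν ω : ℤ → ℝ}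

theorem wnorm_mono (hp0 : 0 < p) (h : ∀ n, ν n ≤ ω n) (f : C(Circle, A)) :
    wnorm p ν f ≤ wnorm p ω f :=
  ENNReal.tsum_le_tsum fun n => by
    have := ENNReal.ofReal_le_ofReal (h n)
    gcongr

/-- Coefficients are continuous in the sup norm, so they can be summed termwise; subadditivity of `x
↦ x ^ p` then gives the bound. -/
theorem wnorm_le_of_hasSum (hp0 : 0 < p) (hp1 : p ≤ 1) {ι : Type*} {F : ι → C(Circle, A)}
    {f : C(Circle, A)} (h : HasSum F f) : wnorm p ν f ≤ ∑' i, wnorm p ν (F i) := by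
  simp only [wnorm]
  rw [ENNReal.tsum_comm]
  refine ENNReal.tsum_le_tsum fun n => ?_
  rw [ENNReal.tsum_mul_right]
  gcongr
  have h1 : coeff f n = ∑' i, coeff (F i) n := (h.mapL (coeffCLM n)).tsum_eq.symm
  rw [h1]
  refine le_trans ?_ (rpow_tsum_le_tsum_rpow _ hp0 hp1)
  gcongr
  exact enorm_tsum_le_tsum_enorm

theorem wnorm_zero (hp0 : 0 < p) : wnorm p ν (0 : C(Circle, A)) = 0 := by
  have h : ∀ n, coeff (0 : C(Circle, A)) n = 0 := fun n => map_zero (coeffCLM n)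
  simp [wnorm, h, hp0]

theorem wnorm_add_le (hp0 : 0 < p) (hp1 : p ≤ 1) (f g : C(Circle, A)) :
    wnorm p ν (f + g) ≤ wnorm p ν f + wnorm p ν g := by
  simpa using wnorm_le_of_hasSum (ν := ν) hp0 hp1 (hasSum_fintype ![f, g])

theorem wnorm_smul (hp0 : 0 < p) (c : ℂ) (f : C(Circle, A)) :
    wnorm p ν (c • f) = ‖c‖ₑ ^ p * wnorm p ν f := by
  have h : ∀ n, coeff (c • f) n = c • coeff f n := fun n => map_smul (coeffCLM n) c f
  simp only [wnorm, h, enorm_smul, ENNReal.mul_rpow_of_nonneg _ _ hp0.le, mul_assoc,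
    ENNReal.tsum_mul_left]

theorem wnorm_neg (f : C(Circle, A)) : wnorm p ν (-f) = wnorm p ν f := by
  have h : ∀ n, coeff (-f) n = -coeff f n := fun n => map_neg (coeffCLM n) f
  simp only [wnorm, h, enorm_neg]

theorem wnorm_shift_le (hp0 : 0 < p) (hν : IsWeight ν) (k : ℤ) (f : C(Circle, A)) :
    wnorm p ν (shift k f) ≤ ENNReal.ofReal (ν k) ^ p * wnorm p ν f := by
  simp only [wnorm, coeff_shift]
  rw [← (Equiv.addRight k).tsum_eq, ← ENNReal.tsum_mul_left]
  refine ENNReal.tsum_le_tsum fun n => ?_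
  rw [Equiv.coe_addRight, add_sub_cancel_right, mul_left_comm,
    ← ENNReal.mul_rpow_of_nonneg (ENNReal.ofReal (ν k)) _ hp0.le,
    ← ENNReal.ofReal_mul (zero_le_one.trans (hν.one_le k)), mul_comm (ν k)]
  have := ENNReal.ofReal_le_ofReal (hν.submul n k)
  gcongr

theorem wnorm_const_mul_le (hp0 : 0 < p) (a : A) (f : C(Circle, A)) :
    wnorm p ν (ContinuousMap.const Circle a * f) ≤ ‖a‖ₑ ^ p * wnorm p ν f := by
  simp only [wnorm, coeff_const_mul]
  rw [← ENNReal.tsum_mul_left]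
  refine ENNReal.tsum_le_tsum fun n => ?_
  rw [← mul_assoc, ← ENNReal.mul_rpow_of_nonneg ‖a‖ₑ _ hp0.le]
  gcongr
  exact enorm_mul_le' _ _

theorem summable_norm_coeff (hp0 : 0 < p) (hp1 : p ≤ 1) (hν : IsWeight ν) {f : C(Circle, A)}
    (h : wnorm p ν f ≠ ∞) : Summable fun n => ‖coeff f n‖ := by
  have h1 : (∑' n, ‖coeff f n‖ₑ) ^ p ≤ wnorm p ν f := by
    refine (rpow_tsum_le_tsum_rpow _ hp0 hp1).trans (ENNReal.tsum_le_tsum fun n => ?_)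
    refine le_mul_of_one_le_right' (ENNReal.one_le_rpow ?_ hp0)
    exact ENNReal.one_le_ofReal.2 (hν.one_le n)
  have h2 : ∑' n, ‖coeff f n‖ₑ ≠ ∞ := fun h3 => h (by
    rw [h3, ENNReal.top_rpow_of_pos hp0] at h1
    exact top_le_iff.1 h1)
  refine (ENNReal.summable_toReal h2).congr fun n => by simp

theorem wnorm_eq_tsum_ofReal (hp0 : 0 < p) (hν : IsWeight ν) (f : C(Circle, A)) :
    wnorm p ν f = ∑' n, ENNReal.ofReal (‖coeff f n‖ ^ p * ν n ^ p) := by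
  refine tsum_congr fun n => ?_
  rw [ENNReal.ofReal_mul (by positivity), ← ENNReal.ofReal_rpow_of_nonneg (norm_nonneg _) hp0.le,
    ← ENNReal.ofReal_rpow_of_nonneg (zero_le_one.trans (hν.one_le n)) hp0.le, ofReal_norm]

theorem HasACFS.wnorm_ne_top (hp0 : 0 < p) (hν : IsWeight ν) {f : C(Circle, A)}
    (h : HasACFS p ν f) : wnorm p ν f ≠ ∞ := by
  rw [wnorm_eq_tsum_ofReal hp0 hν]
  exact h.summable.tsum_ofReal_ne_top

variable [CompleteSpace A]

theorem hasACFS_of_wnorm_ne_top (hp0 : 0 < p) (hp1 : p ≤ 1) (hν : IsWeight ν) {f : C(Circle, A)}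
    (h : wnorm p ν f ≠ ∞) : HasACFS p ν f where
  hasSum := hasSum_coeff_apply (summable_norm_coeff hp0 hp1 hν h)
  summable := by
    rw [wnorm_eq_tsum_ofReal hp0 hν] at h
    refine (ENNReal.summable_toReal h).congr fun n => ENNReal.toReal_ofReal ?_
    have := zero_le_one.trans (hν.one_le n)
    positivity

theorem hasSum_shift_const_mul {f : C(Circle, A)} (h : Summable fun n => ‖coeff f n‖)
    (g : C(Circle, A)) :
    HasSum (fun n : ℤ => shift n (ContinuousMap.const Circle (coeff f n) * g)) (f * g) := by
  simpa only [shift_mul] using (hasSum_shift_coeff h).mul_right g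

/-- Expanding only `f` into monomials writes `f * g` as a sum of shifted constant multiples of `g`,
so no convolution formula is needed. -/
theorem wnorm_mul_le (hp0 : 0 < p) (hp1 : p ≤ 1) (hν : IsWeight ν) {f : C(Circle, A)}
    (hf : wnorm p ν f ≠ ∞) (g : C(Circle, A)) :
    wnorm p ν (f * g) ≤ wnorm p ν f * wnorm p ν g := by
  refine (wnorm_le_of_hasSum hp0 hp1
    (hasSum_shift_const_mul (summable_norm_coeff hp0 hp1 hν hf) g)).trans ?_
  rw [wnorm, ← ENNReal.tsum_mul_right]
  refine ENNReal.tsum_le_tsum fun n => (wnorm_shift_le hp0 hν _ _).trans ?_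
  rw [mul_comm (‖coeff f n‖ₑ ^ p), mul_assoc]
  gcongr
  exact wnorm_const_mul_le hp0 _ _

theorem wnorm_shift_const_ne_top (hp0 : 0 < p) (hν : IsWeight ν) (k : ℤ) (a : A) :
    wnorm p ν (shift k (ContinuousMap.const Circle a)) ≠ ∞ := by
  refine ne_top_of_le_ne_top ?_ (wnorm_shift_le hp0 hν k _)
  refine ENNReal.mul_ne_top (ENNReal.rpow_ne_top_of_nonneg hp0.le ENNReal.ofReal_ne_top) ?_
  rw [wnorm, tsum_eq_single 0 fun n hn => by simp [coeff_const, hn, hp0]]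
  exact ENNReal.mul_ne_top (ENNReal.rpow_ne_top_of_nonneg hp0.le enorm_ne_top)
    (ENNReal.rpow_ne_top_of_nonneg hp0.le ENNReal.ofReal_ne_top)

theorem wnorm_one_ne_top (hp0 : 0 < p) (hν : IsWeight ν) :
    wnorm p ν (1 : C(Circle, A)) ≠ ∞ := by
  convert wnorm_shift_const_ne_top hp0 hν 0 (1 : A)
  ext z; simp

/-! ### Growth of powers of a perturbed trigonometric polynomial. -/

theorem coeff_mul_eq_zero {Q F : C(Circle, A)} {M D : ℕ} (hQ : ∀ n : ℤ, M < n.natAbs → coeff Q n = 0)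
    (hF : ∀ n : ℤ, D < n.natAbs → coeff F n = 0) {n : ℤ} (hn : D + M < n.natAbs) :
    coeff (Q * F) n = 0 := by
  have hs : Summable fun n => ‖coeff Q n‖ := by
    refine summable_of_ne_finset_zero (s := Finset.Icc (-M : ℤ) M) fun n hn => ?_
    rw [hQ n (by rw [Finset.mem_Icc] at hn; omega), norm_zero]
  refine ((hasSum_shift_const_mul hs F).mapL (coeffCLM n)).unique ?_
  convert hasSum_zero with k
  rw [coeffCLM_apply, coeff_shift, coeff_const_mul]
  by_cases hk : M < k.natAbs
  · rw [hQ k hk, zero_mul]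
  · rw [hF _ (by omega), mul_zero]

/-- The `p`-norm of the constant sequence `1` restricted to `[-D, D]`. -/
noncomputable def ballMass (p : ℝ) (ν : ℤ → ℝ) (D : ℕ) : ℝ≥0∞ :=
  ∑ j ∈ Finset.Icc (-D : ℤ) D, ENNReal.ofReal (ν j) ^ p

theorem ballMass_mono : Monotone (ballMass p ν) := fun a b h =>
  Finset.sum_le_sum_of_subset (Finset.Icc_subset_Icc (by omega) (by omega))

omit [CompleteSpace A] in
theorem wnorm_le_ballMass_mul (hp0 : 0 < p) {F : C(Circle, A)} {D : ℕ}
    (hF : ∀ n : ℤ, D < n.natAbs → coeff F n = 0) :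
    wnorm p ν F ≤ ballMass p ν D * ‖F‖ₑ ^ p := by
  rw [wnorm, tsum_eq_sum (s := Finset.Icc (-D : ℤ) D), ballMass, Finset.sum_mul]
  · refine Finset.sum_le_sum fun n _ => ?_
    rw [mul_comm]
    gcongr
    rw [← ofReal_norm, ← ofReal_norm]
    exact ENNReal.ofReal_le_ofReal (norm_coeff_le F n)
  · intro n hn
    rw [hF n (by rw [Finset.mem_Icc] at hn; omega)]
    simp [hp0]

/-- Growth of powers in the weighted `p`-norm: a trigonometric polynomial `Q` enters only through
its supremum norm. -/
theorem wnorm_pow_mul_le (hp0 : 0 < p) (hp1 : p ≤ 1) (hν : IsWeight ν) {Q e : C(Circle, A)} {M : ℕ}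
    (hQ : ∀ n : ℤ, M < n.natAbs → coeff Q n = 0) (he : wnorm p ν e ≠ ∞) (n : ℕ) :
    ∀ (D : ℕ) (F : C(Circle, A)), (∀ n : ℤ, D < n.natAbs → coeff F n = 0) →
      wnorm p ν ((Q + e) ^ n * F) ≤
        ballMass p ν (D + M * n) * (‖Q‖ₑ ^ p + wnorm p ν e) ^ n * ‖F‖ₑ ^ p := by
  -- `D` and `F` stay general so that the last factor of the power can be moved into `F`.
  induction n with
  | zero =>
    intro D F hF
    simpa using wnorm_le_ballMass_mul hp0 hF
  | succ n ih =>
    intro D F hF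
    set θ := ‖Q‖ₑ ^ p + wnorm p ν e
    set B := ballMass p ν (D + M * (n + 1))
    -- Absorbing `Q` raises the degree bound by `M` and costs only its sup norm.
    have h1 : wnorm p ν ((Q + e) ^ n * (Q * F)) ≤ B * θ ^ n * (‖Q‖ₑ ^ p * ‖F‖ₑ ^ p) := by
      refine (ih (D + M) (Q * F) fun k hk => coeff_mul_eq_zero hQ hF hk).trans ?_
      rw [← ENNReal.mul_rpow_of_nonneg _ _ hp0.le]
      gcongr
      · exact ballMass_mono (by ring_nf; omega)
      · exact enorm_mul_le' Q F
    -- For each monomial of `e`, the scalar power of `z` is pulled out of the product at cost `ν k ^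
    -- p`; only the constant coefficient is absorbed, so the degree bound of `F` is kept.
    have h2 : wnorm p ν ((Q + e) ^ n * (e * F)) ≤ B * θ ^ n * (wnorm p ν e * ‖F‖ₑ ^ p) := by
      have hs := (hasSum_shift_const_mul (summable_norm_coeff hp0 hp1 hν he) F).mul_left
        ((Q + e) ^ n)
      refine (wnorm_le_of_hasSum hp0 hp1 hs).trans ?_
      rw [wnorm, ← ENNReal.tsum_mul_right, ← ENNReal.tsum_mul_left]
      refine ENNReal.tsum_le_tsum fun k => ?_
      rw [mul_shift]
      refine (wnorm_shift_le hp0 hν _ _).trans ?_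
      have h3 := ih D (ContinuousMap.const Circle (coeff e k) * F) fun j hj => by
        rw [coeff_const_mul, hF j hj, mul_zero]
      have h4 : ‖ContinuousMap.const Circle (coeff e k) * F‖ₑ ≤ ‖coeff e k‖ₑ * ‖F‖ₑ := by
        refine (enorm_mul_le' _ _).trans ?_
        gcongr
        rw [← ofReal_norm, ← ofReal_norm]
        exact ENNReal.ofReal_le_ofReal (norm_const_le _)
      calc ENNReal.ofReal (ν k) ^ p *
            wnorm p ν ((Q + e) ^ n * (ContinuousMap.const Circle (coeff e k) * F))
          ≤ ENNReal.ofReal (ν k) ^ p * (B * θ ^ n * (‖coeff e k‖ₑ ^ p * ‖F‖ₑ ^ p)) := by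
            rw [← ENNReal.mul_rpow_of_nonneg _ _ hp0.le]
            gcongr
            refine h3.trans ?_
            gcongr
            exact ballMass_mono (by ring_nf; omega)
        _ = _ := by ring
    calc wnorm p ν ((Q + e) ^ (n + 1) * F)
        = wnorm p ν ((Q + e) ^ n * (Q * F) + (Q + e) ^ n * (e * F)) := by
          congr 1; rw [pow_succ]; noncomm_ring
      _ ≤ _ := (wnorm_add_le hp0 hp1 _ _).trans (add_le_add h1 h2)
      _ = _ := by simp only [θ]; ring

end

/-! ### The Neumann series in the weighted norm. -/

section

variable {A : Type*} [NormedRing A] [NormedAlgebra ℂ A] [CompleteSpace A]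
variable {p : ℝ} {ν ω : ℤ → ℝ}

theorem coeff_sum_shift_const (s : Finset ℤ) (a : ℤ → A) (n : ℤ) :
    coeff (∑ k ∈ s, shift k (ContinuousMap.const Circle (a k))) n = if n ∈ s then a n else 0 := by
  rw [← coeffCLM_apply, map_sum]
  simp only [coeffCLM_apply, coeff_shift, coeff_const, sub_eq_zero]
  exact Finset.sum_ite_eq s n a

/-- Finite partial Fourier sums converge to `u` in sup norm and their remainders vanish in the
weighted norm, so the quantity to bound tends to `‖u‖ ^ p < 1`. -/
theorem exists_trigPoly_add_small (hp0 : 0 < p) (hp1 : p ≤ 1) (hω : IsWeight ω) {u : C(Circle, A)}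
    (hu : wnorm p ω u ≠ ∞) (hu1 : ‖u‖ < 1) :
    ∃ (M : ℕ) (Q e : C(Circle, A)), u = Q + e ∧ (∀ n : ℤ, M < n.natAbs → coeff Q n = 0) ∧
      ‖Q‖ₑ ^ p + wnorm p ω e < 1 := by
  let Q : Finset ℤ → C(Circle, A) := fun s =>
    ∑ k ∈ s, shift k (ContinuousMap.const Circle (coeff u k))
  have h1 : Tendsto (fun s => ‖Q s‖ₑ ^ p) atTop (𝓝 (‖u‖ₑ ^ p)) :=
    (ENNReal.continuous_rpow_const.comp continuous_enorm).continuousAt.tendsto.comp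
      (hasSum_shift_coeff (summable_norm_coeff hp0 hp1 hω hu))
  have h2 : Tendsto (fun s => wnorm p ω (u - Q s)) atTop (𝓝 0) := by
    refine (ENNReal.tendsto_tsum_compl_atTop_zero hu).congr fun s => ?_
    rw [wnorm, ← ENNReal.summable.tsum_add_tsum_compl (s := (s : Set ℤ)) ENNReal.summable]
    have h3 : ∀ n, coeff (u - Q s) n = if n ∈ s then 0 else coeff u n := fun n => by
      rw [← coeffCLM_apply, map_sub, coeffCLM_apply, coeffCLM_apply, coeff_sum_shift_const]
      split_ifs <;> simp
    simp only [h3]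
    have h4 : ∀ n : (s : Set ℤ), (n : ℤ) ∈ s := fun n => n.2
    have h5 : ∀ n : ((s : Set ℤ)ᶜ : Set ℤ), (n : ℤ) ∉ s := fun n => n.2
    simp only [h4, h5, if_true, if_false, enorm_zero, ENNReal.zero_rpow_of_pos hp0, zero_mul,
      tsum_zero, zero_add]
    rfl
  have h6 : ‖u‖ₑ ^ p + 0 < 1 := by
    rw [add_zero]
    refine ENNReal.rpow_lt_one ?_ hp0
    rw [← ofReal_norm]
    exact ENNReal.ofReal_lt_one.2 hu1
  obtain ⟨s, hs⟩ := ((h1.add h2).eventually_lt_const h6).exists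
  refine ⟨s.sup Int.natAbs, Q s, u - Q s, by abel, fun n hn => ?_, hs⟩
  rw [coeff_sum_shift_const, if_neg fun h => hn.not_ge (Finset.le_sup h)]

theorem ballMass_le (hp0 : 0 < p) {C R : ℝ} (hR : 1 ≤ R) (hC : ∀ j, ν j ≤ C * R ^ j.natAbs)
    (D : ℕ) : ballMass p ν D ≤ ENNReal.ofReal C ^ p * ((2 * D + 1 : ℕ) * (ENNReal.ofReal R ^ p) ^ D) := by
  have h : ∀ j ∈ Finset.Icc (-D : ℤ) D,
      ENNReal.ofReal (ν j) ^ p ≤ ENNReal.ofReal C ^ p * (ENNReal.ofReal R ^ p) ^ D := by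
    intro j hj
    rw [← ENNReal.rpow_mul_natCast, mul_comm p, ENNReal.rpow_natCast_mul,
      ← ENNReal.mul_rpow_of_nonneg _ _ hp0.le]
    gcongr
    refine (ENNReal.ofReal_le_ofReal (hC j)).trans ?_
    rw [ENNReal.ofReal_mul' (by positivity), ENNReal.ofReal_pow (by positivity)]
    gcongr
    · exact ENNReal.one_le_ofReal.2 hR
    · rw [Finset.mem_Icc] at hj; omega
  refine (Finset.sum_le_card_nsmul _ _ _ h).trans (le_of_eq ?_)
  rw [Int.card_Icc, nsmul_eq_mul, show ((D : ℤ) + 1 - -D).toNat = 2 * D + 1 by omega]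
  ring

theorem exists_one_lt_rpow_mul_lt (p : ℝ) (M : ℕ) {θ : ℝ≥0∞} (hθ : θ < 1) :
    ∃ R : ℝ, 1 < R ∧ (ENNReal.ofReal R ^ p) ^ M * θ < 1 := by
  have h : Tendsto (fun R : ℝ => (ENNReal.ofReal R ^ p) ^ M * θ) (𝓝[>] 1) (𝓝 (1 * θ)) := by
    refine ENNReal.Tendsto.mul_const ?_ (Or.inl one_ne_zero)
    have : Continuous fun R : ℝ => (ENNReal.ofReal R ^ p) ^ M :=
      (ENNReal.continuous_pow M).comp
        (ENNReal.continuous_rpow_const.comp ENNReal.continuous_ofReal)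
    simpa using (this.tendsto 1).mono_left nhdsWithin_le_nhds
  have h2 := (h.eventually_lt_const (by rwa [one_mul])).and self_mem_nhdsWithin
  obtain ⟨R, hR, hR1⟩ := h2.exists
  exact ⟨R, hR1, hR⟩

theorem tsum_linear_mul_geometric_ne_top (M : ℕ) {r : ℝ≥0∞} (hr : r < 1) :
    ∑' n : ℕ, ((2 * (M * n) + 1 : ℕ) : ℝ≥0∞) * r ^ n ≠ ∞ := by
  lift r to NNReal using hr.ne_top
  have hr' : ‖(r : ℝ)‖ < 1 := by simpa using hr
  have h1 := (summable_pow_mul_geometric_of_norm_lt_one 1 hr').mul_left (2 * M : ℝ)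
  have h2 := h1.add (summable_geometric_of_norm_lt_one hr')
  have h3 : Summable fun n : ℕ => ((2 * (M * n) + 1 : ℕ) : NNReal) * r ^ n := by
    rw [← NNReal.summable_coe]
    refine h2.congr fun n => ?_
    push_cast
    ring
  convert ENNReal.tsum_coe_ne_top_iff_summable.2 h3 with n
  push_cast
  rfl

/-- If `‖u‖ < 1`, the Neumann series of `u` has finite `p`-norm with respect to every weight below
`ω` of sufficiently small exponential growth. -/
theorem exists_inverse_one_sub (hp0 : 0 < p) (hp1 : p ≤ 1) (hω : IsWeight ω) {u : C(Circle, A)}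
    (hu : wnorm p ω u ≠ ∞) (hu1 : ‖u‖ < 1) :
    ∃ (S : C(Circle, A)) (R : ℝ), S * (1 - u) = 1 ∧ (1 - u) * S = 1 ∧ 1 < R ∧
      ∀ ν, IsWeight ν → (∀ n, ν n ≤ ω n) → (∃ C, ∀ j, ν j ≤ C * R ^ j.natAbs) →
        wnorm p ν S ≠ ∞ := by
  obtain ⟨M, Q, e, rfl, hQ, hθ⟩ := exists_trigPoly_add_small hp0 hp1 hω hu hu1
  -- `R` is fixed from the splitting for `ω`, before any `ν` is given; passing to `ν ≤ ω` only
  -- decreases the norm of `e`.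
  obtain ⟨R, hR, hRθ⟩ := exists_one_lt_rpow_mul_lt p M hθ
  refine ⟨∑' n : ℕ, (Q + e) ^ n, R, geom_series_mul_neg _ hu1, mul_neg_geom_series _ hu1, hR,
    fun ν hν hνω ⟨C, hC⟩ => ?_⟩
  have hs : HasSum (fun n : ℕ => (Q + e) ^ n) (∑' n : ℕ, (Q + e) ^ n) :=
    (summable_geometric_of_norm_lt_one hu1).hasSum
  refine ne_top_of_le_ne_top ?_ (wnorm_le_of_hasSum hp0 hp1 hs)
  have he := wnorm_mono hp0 hνω e
  have he' : wnorm p ν e ≠ ∞ :=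
    ne_top_of_le_ne_top (ne_top_of_le_ne_top hθ.ne_top le_add_self) he
  have h1 : ∀ n : ℤ, 0 < n.natAbs → coeff (1 : C(Circle, A)) n = 0 := fun n hn => by
    have := coeff_const (1 : A) n
    rw [if_neg (by omega)] at this
    exact this
  have key : ∀ n : ℕ, wnorm p ν ((Q + e) ^ n) ≤
      ENNReal.ofReal C ^ p * ‖(1 : C(Circle, A))‖ₑ ^ p * (((2 * (M * n) + 1 : ℕ) : ℝ≥0∞) *
        ((ENNReal.ofReal R ^ p) ^ M * (‖Q‖ₑ ^ p + wnorm p ω e)) ^ n) := fun n => by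
    have h2 := wnorm_pow_mul_le hp0 hp1 hν hQ he' n 0 1 h1
    rw [mul_one, zero_add] at h2
    calc _ ≤ _ := h2
      _ ≤ ENNReal.ofReal C ^ p * ((2 * (M * n) + 1 : ℕ) * (ENNReal.ofReal R ^ p) ^ (M * n)) *
          (‖Q‖ₑ ^ p + wnorm p ω e) ^ n * ‖(1 : C(Circle, A))‖ₑ ^ p := by
        gcongr
        exact ballMass_le hp0 hR.le hC _
      _ = _ := by rw [mul_pow, pow_mul]; ring
  refine ne_top_of_le_ne_top ?_ (ENNReal.tsum_le_tsum key)
  rw [ENNReal.tsum_mul_left]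
  exact ENNReal.mul_ne_top (ENNReal.mul_ne_top
    (ENNReal.rpow_ne_top_of_nonneg hp0.le ENNReal.ofReal_ne_top)
    (ENNReal.rpow_ne_top_of_nonneg hp0.le enorm_ne_top)) (tsum_linear_mul_geometric_ne_top M hRθ)

/-! ### Density of functions with finite weighted norm. -/

-- With a partition of unity subordinate to sets where `f` is nearly constant, the sum at `y` is a
-- convex combination of values close to `f y`.
omit [NormedAlgebra ℂ A] [CompleteSpace A] in
theorem exists_sum_smul_apply_near {X E : Type*} [TopologicalSpace X] [CompactSpace X] [T2Space X]
    [NormedAddCommGroup E] [NormedSpace ℝ E] (f : C(X, E)) {ε : ℝ} (hε : 0 < ε) :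
    ∃ (t : Finset X) (ρ : X → C(X, ℝ)),
      ‖f - ∑ x ∈ t, (⟨fun y => ρ x y • f x, by fun_prop⟩ : C(X, E))‖ < ε := by
  let U : X → Set X := fun x => {y | f x ∈ Metric.ball (f y) (ε / 2)}
  have hU : ∀ x, IsOpen (U x) := fun x => by
    have : Continuous fun y => dist (f x) (f y) := by fun_prop
    exact isOpen_lt this continuous_const
  obtain ⟨ρ, hρ⟩ := PartitionOfUnity.exists_isSubordinate isClosed_univ U hU fun x _ =>
    Set.mem_iUnion.2 ⟨x, by simpa [U] using hε⟩
  have hfin := ρ.locallyFinite.finite_nonempty_of_compact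
  refine ⟨hfin.toFinset, fun x => ρ x, (ContinuousMap.norm_lt_iff _ hε).2 fun y => ?_⟩
  have h1 := ρ.finsum_smul_mem_convex (x := y) (g := fun x _ => f x) (Set.mem_univ y)
    (fun x hx => hρ x (subset_closure hx)) (convex_ball (f y) (ε / 2))
  rw [finsum_eq_sum_of_support_subset (s := hfin.toFinset) _ fun x hx => by
    rw [Set.Finite.coe_toFinset]
    exact ⟨y, fun h0 => hx (by simp [h0])⟩] at h1
  rw [ContinuousMap.sub_apply, ContinuousMap.sum_apply, ← dist_eq_norm, dist_comm]
  exact (Metric.mem_ball.1 h1).trans (by linarith)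

/-- Functions with finite `p`-norm are dense among the continuous functions on the circle. -/
theorem exists_wnorm_ne_top_near (hp0 : 0 < p) (hp1 : p ≤ 1) (hν : IsWeight ν) (h : C(Circle, A))
    {ε : ℝ} (hε : 0 < ε) : ∃ g : C(Circle, A), wnorm p ν g ≠ ∞ ∧ ‖h - g‖ < ε := by
  let V : Submodule ℂ C(Circle, A) :=
    { carrier := {g | wnorm p ν g ≠ ∞}
      add_mem' := fun {f g} hf hg =>
        ne_top_of_le_ne_top (ENNReal.add_ne_top.2 ⟨hf, hg⟩) (wnorm_add_le hp0 hp1 f g)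
      zero_mem' := by simp [wnorm_zero hp0]
      smul_mem' := fun c f hf => by
        rw [Set.mem_ofPred_eq, wnorm_smul hp0]
        exact ENNReal.mul_ne_top (ENNReal.rpow_ne_top_of_nonneg hp0.le enorm_ne_top) hf }
  suffices hV : h ∈ closure (V : Set C(Circle, A)) by
    obtain ⟨g, hg, hgε⟩ := Metric.mem_closure_iff.1 hV ε hε
    exact ⟨g, hg, by rwa [dist_eq_norm] at hgε⟩
  let e := homeomorphCircle Real.two_pi_pos.ne'
  -- Scalar trigonometric polynomials are dense; multiplication by `b` maps them into `V` and is
  -- continuous.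
  have hsmul : ∀ (ψ : C(Circle, ℂ)) (b : A),
      (⟨fun z => ψ z • b, by fun_prop⟩ : C(Circle, A)) ∈ V.topologicalClosure := by
    intro ψ b
    let L : C(AddCircle (2 * π), ℂ) →L[ℂ] C(Circle, A) :=
      LinearMap.mkContinuous
        { toFun := fun φ => ⟨fun z => φ (e.symm z) • b, by fun_prop⟩
          map_add' := fun φ χ => by ext z; simp [add_smul]
          map_smul' := fun c φ => by ext z; simp [mul_smul] } ‖b‖ fun φ => by
        refine (ContinuousMap.norm_le _ (by positivity)).2 fun z => ?_
        rw [mul_comm ‖b‖ ‖φ‖]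
        exact (norm_smul_le _ _).trans (by gcongr; exact φ.norm_coe_le_norm _)
    have hL : ∀ φ z, L φ z = φ (e.symm z) • b := fun φ z => rfl
    have h1 : (Submodule.span ℂ (Set.range (fourier (T := 2 * π)))).map (L : _ →ₗ[ℂ] _) ≤ V := by
      rw [Submodule.map_span_le]
      rintro _ ⟨n, rfl⟩
      have h0 : L (fourier n) = shift n (ContinuousMap.const Circle b) := by
        ext z
        obtain ⟨t, rfl⟩ := e.surjective z
        rw [hL, e.symm_apply_apply, shift_apply,
          show e t = t.toCircle from homeomorphCircle_apply _ t, fourier_apply, toCircle_zsmul,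
          Circle.coe_zpow, ContinuousMap.const_apply]
      change L (fourier n) ∈ V
      rw [h0]
      exact wnorm_shift_const_ne_top hp0 hν n b
    have h2 : (⟨fun t => ψ (e t), by fun_prop⟩ : C(AddCircle (2 * π), ℂ)) ∈
        closure (Submodule.span ℂ (Set.range (fourier (T := 2 * π))) : Set _) := by
      rw [← Submodule.topologicalClosure_coe, span_fourier_closure_eq_top]
      trivial
    have h3 := map_mem_closure L.continuous h2 fun φ hφ => h1 (Submodule.mem_map_of_mem hφ)
    have h4 : L ⟨fun t => ψ (e t), by fun_prop⟩ = ⟨fun z => ψ z • b, by fun_prop⟩ := by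
      ext z
      simp [hL]
    rwa [h4] at h3
  suffices hV' : h ∈ closure (V.topologicalClosure : Set C(Circle, A)) by
    rwa [Submodule.topologicalClosure_coe, closure_closure] at hV'
  refine Metric.mem_closure_iff.2 fun ε hε => ?_
  obtain ⟨t, ρ, hρ⟩ := exists_sum_smul_apply_near h hε
  refine ⟨_, Submodule.sum_mem _ fun x (_ : x ∈ t) =>
    hsmul ⟨fun z => (ρ x z : ℂ), by fun_prop⟩ (h x), ?_⟩
  rw [dist_eq_norm]
  refine lt_of_eq_of_lt (congrArg (fun g => ‖h - g‖) ?_) hρ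
  ext z
  simp [ContinuousMap.sum_apply]

end

/-! ### Gluing and correcting one-sided inverses. -/

section

variable {A : Type*} [NormedRing A] [NormedAlgebra ℂ A] [CompleteSpace A]
variable {p : ℝ} {ν ω : ℤ → ℝ}

theorem exists_leftInverse (hp0 : 0 < p) (hp1 : p ≤ 1) (hω : IsWeight ω) {f : C(Circle, A)}
    (hf : HasACFS p ω f) (hinv : ∀ z, ∃ b, b * f z = 1) :
    ∃ (g : C(Circle, A)) (R : ℝ), (∀ z, g z * f z = 1) ∧ 1 < R ∧
      ∀ ν, IsWeight ν → (∀ n, ν n ≤ ω n) → (∃ C, ∀ j, ν j ≤ C * R ^ j.natAbs) →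
        HasACFS p ν g := by
  -- A left inverse of `f z` remains an approximate left inverse of `f y` for `y` near `z`, which
  -- supplies the locally constant selections.
  obtain ⟨h₀, hh₀⟩ := exists_continuous_forall_mem_convex_of_local_const
    (t := fun z => {b : A | ‖1 - b * f z‖ < 1 / 2})
    (fun z => by
      have h := (convex_ball (1 : A) (1 / 2)).linear_preimage
        (LinearMap.mulRight ℝ (f z))
      have hs : {b : A | ‖1 - b * f z‖ < 1 / 2} =
          LinearMap.mulRight ℝ (f z) ⁻¹' Metric.ball (1 : A) (1 / 2) := by
        ext b
        change _ ↔ b * f z ∈ Metric.ball (1 : A) (1 / 2)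
        rw [mem_ball_iff_norm']
        rfl
      rw [hs]
      exact h)
    (fun z => by
      obtain ⟨b, hb⟩ := hinv z
      refine ⟨b, ?_⟩
      have hc : Continuous fun y => ‖1 - b * f y‖ := by fun_prop
      exact (hc.tendsto z).eventually_lt_const (by simp [hb]))
  obtain ⟨h, hhω, hh⟩ := exists_wnorm_ne_top_near hp0 hp1 hω h₀
    -- This makes `‖(h₀ - h) * f‖ ≤ 1/2`; the `+ 1` covers `f = 0`.
    (ε := 1 / (2 * (‖f‖ + 1))) (by positivity)
  have hfω := hf.wnorm_ne_top hp0 hω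
  have hu : wnorm p ω (1 - h * f) ≠ ∞ := by
    rw [sub_eq_add_neg]
    refine ne_top_of_le_ne_top (ENNReal.add_ne_top.2 ⟨wnorm_one_ne_top hp0 hω, ?_⟩)
      (wnorm_add_le hp0 hp1 _ _)
    rw [wnorm_neg]
    exact ne_top_of_le_ne_top (ENNReal.mul_ne_top hhω hfω) (wnorm_mul_le hp0 hp1 hω hhω f)
  have hu1 : ‖1 - h * f‖ < 1 := by
    have h1 : ‖1 - h₀ * f‖ < 1 / 2 := (ContinuousMap.norm_lt_iff _ (by norm_num)).2 hh₀
    have h2 : ‖(h₀ - h) * f‖ ≤ 1 / 2 := by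
      refine (norm_mul_le _ _).trans ?_
      calc ‖h₀ - h‖ * ‖f‖ ≤ 1 / (2 * (‖f‖ + 1)) * (‖f‖ + 1) := by
            gcongr; linarith
        _ = 1 / 2 := by field_simp
    calc ‖1 - h * f‖ = ‖(1 - h₀ * f) + (h₀ - h) * f‖ := by congr 1; noncomm_ring
      _ ≤ _ := norm_add_le _ _
      _ < 1 := by linarith
  obtain ⟨S, R, hS, -, hR, hSν⟩ := exists_inverse_one_sub hp0 hp1 hω hu hu1
  rw [sub_sub_cancel] at hS
  refine ⟨S * h, R, fun z => ?_, hR, fun ν hν hνω hC => ?_⟩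
  · have := DFunLike.congr_fun hS z
    simpa [mul_assoc] using this
  · have h1 := hSν ν hν hνω hC
    exact hasACFS_of_wnorm_ne_top hp0 hp1 hν (ne_top_of_le_ne_top (ENNReal.mul_ne_top h1
      (ne_top_of_le_ne_top hhω (wnorm_mono hp0 hνω h))) (wnorm_mul_le hp0 hp1 hν h1 h))

theorem exists_rightInverse (hp0 : 0 < p) (hp1 : p ≤ 1) (hω : IsWeight ω) {f : C(Circle, A)}
    (hf : HasACFS p ω f) (hinv : ∀ z, ∃ b, f z * b = 1) :
    ∃ (g : C(Circle, A)) (R : ℝ), (∀ z, f z * g z = 1) ∧ 1 < R ∧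
      ∀ ν, IsWeight ν → (∀ n, ν n ≤ ω n) → (∃ C, ∀ j, ν j ≤ C * R ^ j.natAbs) →
        HasACFS p ν g := by
  obtain ⟨h₀, hh₀⟩ := exists_continuous_forall_mem_convex_of_local_const
    (t := fun z => {b : A | ‖1 - f z * b‖ < 1 / 2})
    (fun z => by
      have h := (convex_ball (1 : A) (1 / 2)).linear_preimage
        (LinearMap.mulLeft ℝ (f z))
      have hs : {b : A | ‖1 - f z * b‖ < 1 / 2} =
          LinearMap.mulLeft ℝ (f z) ⁻¹' Metric.ball (1 : A) (1 / 2) := by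
        ext b
        change _ ↔ f z * b ∈ Metric.ball (1 : A) (1 / 2)
        rw [mem_ball_iff_norm']
        rfl
      rw [hs]
      exact h)
    (fun z => by
      obtain ⟨b, hb⟩ := hinv z
      refine ⟨b, ?_⟩
      have hc : Continuous fun y => ‖1 - f y * b‖ := by fun_prop
      exact (hc.tendsto z).eventually_lt_const (by simp [hb]))
  obtain ⟨h, hhω, hh⟩ := exists_wnorm_ne_top_near hp0 hp1 hω h₀
    (ε := 1 / (2 * (‖f‖ + 1))) (by positivity)
  have hfω := hf.wnorm_ne_top hp0 hω
  have hu : wnorm p ω (1 - f * h) ≠ ∞ := by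
    rw [sub_eq_add_neg]
    refine ne_top_of_le_ne_top (ENNReal.add_ne_top.2 ⟨wnorm_one_ne_top hp0 hω, ?_⟩)
      (wnorm_add_le hp0 hp1 _ _)
    rw [wnorm_neg]
    exact ne_top_of_le_ne_top (ENNReal.mul_ne_top hfω hhω) (wnorm_mul_le hp0 hp1 hω hfω h)
  have hu1 : ‖1 - f * h‖ < 1 := by
    have h1 : ‖1 - f * h₀‖ < 1 / 2 := (ContinuousMap.norm_lt_iff _ (by norm_num)).2 hh₀
    have h2 : ‖f * (h₀ - h)‖ ≤ 1 / 2 := by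
      refine (norm_mul_le _ _).trans ?_
      calc ‖f‖ * ‖h₀ - h‖ ≤ (‖f‖ + 1) * (1 / (2 * (‖f‖ + 1))) := by
            gcongr; linarith
        _ = 1 / 2 := by field_simp
    calc ‖1 - f * h‖ = ‖(1 - f * h₀) + f * (h₀ - h)‖ := by congr 1; noncomm_ring
      _ ≤ _ := norm_add_le _ _
      _ < 1 := by linarith
  obtain ⟨S, R, -, hS, hR, hSν⟩ := exists_inverse_one_sub hp0 hp1 hω hu hu1
  rw [sub_sub_cancel] at hS
  refine ⟨h * S, R, fun z => ?_, hR, fun ν hν hνω hC => ?_⟩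
  · have := DFunLike.congr_fun hS z
    simpa [mul_assoc] using this
  · have h1 : wnorm p ν h ≠ ∞ := ne_top_of_le_ne_top hhω (wnorm_mono hp0 hνω h)
    exact hasACFS_of_wnorm_ne_top hp0 hp1 hν (ne_top_of_le_ne_top (ENNReal.mul_ne_top h1
      (hSν ν hν hνω hC)) (wnorm_mul_le hp0 hp1 hν h1 S))

/-! ### Exponential growth of weights. -/

theorem IsWeight.pos (hω : IsWeight ω) (n : ℤ) : 0 < ω n := zero_lt_one.trans_le (hω.one_le n)

theorem IsWeight.comp_neg (hω : IsWeight ω) : IsWeight fun n => ω (-n) where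
  one_le n := hω.one_le _
  submul m n := by rw [neg_add]; exact hω.submul _ _

theorem IsWeight.mul_nat_le (hω : IsWeight ω) (m : ℤ) (q : ℕ) (r : ℤ) :
    ω (q * m + r) ≤ ω m ^ q * ω r := by
  induction q with
  | zero => simp
  | succ q ih =>
    calc ω ((q + 1 : ℕ) * m + r) = ω (m + (q * m + r)) := by congr 1; push_cast; ring
      _ ≤ ω m * ω (q * m + r) := hω.submul _ _
      _ ≤ ω m * (ω m ^ q * ω r) := by have := (hω.pos m).le; gcongr
      _ = _ := by ring

/-- Division by `m` reduces everything to one value `ω m` and finitely many remainders, whose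
weights sum to the constant. -/
theorem IsWeight.exists_growth_nat (hω : IsWeight ω) {m : ℕ} (hm : 0 < m) {R : ℝ} (hR : 1 ≤ R)
    (h : ω m ≤ R ^ m) : ∃ C, 0 ≤ C ∧ ∀ n : ℕ, ω n ≤ C * R ^ n := by
  refine ⟨∑ r ∈ Finset.range m, ω r, Finset.sum_nonneg fun r _ => (hω.pos _).le, fun n => ?_⟩
  have h1 := hω.mul_nat_le m (n / m) (n % m : ℕ)
  have h2 : ((n / m : ℕ) : ℤ) * m + (n % m : ℕ) = n := by
    exact_mod_cast Nat.div_add_mod' n m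
  rw [h2] at h1
  have h3 : ω (n % m : ℕ) ≤ ∑ r ∈ Finset.range m, ω r :=
    Finset.single_le_sum (f := fun r : ℕ => ω r) (fun r _ => (hω.pos _).le)
      (Finset.mem_range.2 (Nat.mod_lt n hm))
  calc ω n ≤ _ := h1
    _ ≤ (R ^ m) ^ (n / m) * ∑ r ∈ Finset.range m, ω r := by
      have := (hω.pos m).le
      have := (hω.pos (n % m : ℕ)).le
      gcongr
    _ ≤ R ^ n * ∑ r ∈ Finset.range m, ω r := by
      have := (hω.pos (n % m : ℕ)).le.trans h3
      rw [← pow_mul]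
      gcongr
      exact Nat.mul_div_le n m
    _ = _ := mul_comm _ _

theorem IsWeight.exists_growth (hω : IsWeight ω) {m k : ℕ} (hm : 0 < m) (hk : 0 < k) {R : ℝ}
    (hR : 1 ≤ R) (h : ω m ≤ R ^ m) (h' : ω (-k) ≤ R ^ k) :
    ∃ C, 0 ≤ C ∧ ∀ j : ℤ, ω j ≤ C * R ^ j.natAbs := by
  obtain ⟨C, hC0, hC⟩ := hω.exists_growth_nat hm hR h
  obtain ⟨C', -, hC'⟩ := hω.comp_neg.exists_growth_nat hk hR h'
  refine ⟨max C C', le_max_of_le_left hC0, fun j => ?_⟩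
  have hR0 : 0 ≤ R ^ j.natAbs := by positivity
  obtain hj | hj := Int.natAbs_eq j
  · calc ω j = ω (j.natAbs : ℤ) := by rw [← hj]
      _ ≤ C * R ^ j.natAbs := hC _
      _ ≤ _ := by gcongr; exact le_max_left _ _
  · calc ω j = ω (-(j.natAbs : ℤ)) := by rw [← hj]
      _ ≤ C' * R ^ j.natAbs := hC' _
      _ ≤ _ := by gcongr; exact le_max_right _ _

/-- Admissibility yields a single positive and a single negative index at which the root of `ω` is
below `R`; submultiplicativity propagates this to all of `ℤ`. -/
theorem IsAdmissible.exists_growth (hω : IsWeight ω) (h : IsAdmissible ω) {R : ℝ} (hR : 1 < R) :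
    ∃ C, ∀ j : ℤ, ω j ≤ C * R ^ j.natAbs := by
  have hR0 : 0 < R := zero_lt_one.trans hR
  have hroot : ∀ (n : ℕ) (x : ℝ), 0 < n → 0 < x → x ^ (1 / (n : ℝ)) < R → x ≤ R ^ n := by
    intro n x hn hx hlt
    have h1 := Real.rpow_le_rpow (by positivity) hlt.le (Nat.cast_nonneg (α := ℝ) n)
    rwa [← Real.rpow_mul hx.le, one_div_mul_cancel (by positivity), Real.rpow_one,
      Real.rpow_natCast] at h1
  obtain ⟨_, ⟨m, hm, rfl⟩, hmR⟩ := exists_lt_of_csInf_lt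
    (s := {x | ∃ n : ℕ, 0 < n ∧ x = ω (n : ℤ) ^ (1 / (n : ℝ))}) ⟨_, 1, one_pos, rfl⟩
    (b := R) (by rw [show sInf _ = (1 : ℝ) from h.2]; exact hR)
  obtain ⟨_, ⟨k, hk, rfl⟩, hkR⟩ := exists_lt_of_lt_csSup
    (s := {x | ∃ n : ℕ, 0 < n ∧ x = ω (-(n : ℤ)) ^ (-(1 / (n : ℝ)))}) ⟨_, 1, one_pos, rfl⟩
    (b := R⁻¹) (by rw [show sSup _ = (1 : ℝ) from h.1]; exact inv_lt_one_of_one_lt₀ hR)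
  rw [Real.rpow_neg (hω.pos _).le, inv_lt_inv₀ hR0 (Real.rpow_pos_of_pos (hω.pos _) _)] at hkR
  obtain ⟨C, -, hC⟩ := hω.exists_growth hm hk hR.le (hroot m _ hm (hω.pos _) hmR)
    (hroot k _ hk (hω.pos _) hkR)
  exact ⟨C, hC⟩

theorem IsWeight.rpow (hω : IsWeight ω) {s : ℝ} (hs : 0 ≤ s) : IsWeight fun n => ω n ^ s where
  one_le n := Real.one_le_rpow (hω.one_le n) hs
  submul m n := by
    rw [← Real.mul_rpow (hω.pos m).le (hω.pos n).le]
    exact Real.rpow_le_rpow (hω.pos _).le (hω.submul m n) hs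

theorem isConst_rpow (hω : IsWeight ω) {s : ℝ} (hs : 0 < s) :
    IsConst (fun n => ω n ^ s) ↔ IsConst ω := by
  refine ⟨fun ⟨c, hc⟩ => ⟨c ^ s⁻¹, fun n => ?_⟩, fun ⟨c, hc⟩ => ⟨c ^ s, fun n => by simp only [hc n]⟩⟩
  rw [← hc n, Real.rpow_rpow_inv (hω.pos n).le hs.ne']

/-- Below every weight there is a weight, constant only if the first one is, of prescribed small
exponential growth. -/
theorem IsWeight.exists_slow_weight (hω : IsWeight ω) {R : ℝ} (hR : 1 < R) :
    ∃ ν, IsWeight ν ∧ (∀ n, 1 ≤ ν n ∧ ν n ≤ ω n) ∧ (IsConst ν ↔ IsConst ω) ∧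
      ∃ C, ∀ j : ℤ, ν j ≤ C * R ^ j.natAbs := by
  set K := max (ω 1) (ω (-1))
  have hK : 1 ≤ K := (hω.one_le 1).trans (le_max_left _ _)
  obtain ⟨C, hC0, hC⟩ := hω.exists_growth one_pos one_pos hK (by simp [K]) (by simp [K])
  have ht : Tendsto (fun s : ℝ => K ^ s) (𝓝[>] 0) (𝓝 (K ^ (0 : ℝ))) :=
    ((Real.continuous_const_rpow (by positivity)).tendsto 0).mono_left nhdsWithin_le_nhds
  rw [Real.rpow_zero] at ht
  -- The weight is `ω ^ s`: small `s` brings the rate `K ^ s` below `R`, `s ≤ 1` keeps it under `ω`,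
  -- and `s > 0` preserves nonconstancy.
  obtain ⟨s, ⟨hsR, hs0⟩, hs1⟩ := (((ht.eventually_lt_const hR).and self_mem_nhdsWithin).and
    (nhdsWithin_le_nhds (eventually_le_nhds (zero_lt_one (α := ℝ))))).exists
  have hs0 : 0 < s := hs0
  refine ⟨fun n => ω n ^ s, hω.rpow hs0.le, fun n => ⟨(hω.rpow hs0.le).one_le n, ?_⟩,
    isConst_rpow hω hs0, C ^ s, fun j => ?_⟩
  · exact Real.rpow_le_self_of_one_le (hω.one_le n) hs1
  · calc ω j ^ s ≤ (C * K ^ j.natAbs) ^ s := Real.rpow_le_rpow (hω.pos j).le (hC j) hs0.le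
      _ = C ^ s * (K ^ s) ^ j.natAbs := by
        rw [Real.mul_rpow hC0 (by positivity), Real.rpow_pow_comm (by positivity)]
      _ ≤ _ := by gcongr

end

end WeightedWiener

theorem theorem1p1 {A : Type*} [NormedRing A] [NormedAlgebra ℂ A] [CompleteSpace A]
    (p : ℝ) (hp0 : 0 < p) (hp1 : p ≤ 1)
    (ω : ℤ → ℝ) (hω : WeightedWiener.IsWeight ω)
    (f : C(Circle, A)) (hf : WeightedWiener.HasACFS p ω f) :
    -- left inverses
    ((∀ z, ∃ b, b * f z = 1) →
      (∃ (ν : ℤ → ℝ) (g : C(Circle, A)), WeightedWiener.IsWeight ν ∧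
        (∀ n, 1 ≤ ν n ∧ ν n ≤ ω n) ∧
        (WeightedWiener.IsConst ν ↔ WeightedWiener.IsConst ω) ∧
        WeightedWiener.HasACFS p ν g ∧ (∀ z, g z * f z = 1)) ∧
      (WeightedWiener.IsAdmissible ω →
        ∃ g : C(Circle, A), WeightedWiener.HasACFS p ω g ∧ (∀ z, g z * f z = 1))) ∧
    -- right inverses
    ((∀ z, ∃ b, f z * b = 1) →
      (∃ (ν : ℤ → ℝ) (g : C(Circle, A)), WeightedWiener.IsWeight ν ∧
        (∀ n, 1 ≤ ν n ∧ ν n ≤ ω n) ∧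
        (WeightedWiener.IsConst ν ↔ WeightedWiener.IsConst ω) ∧
        WeightedWiener.HasACFS p ν g ∧ (∀ z, f z * g z = 1)) ∧
      (WeightedWiener.IsAdmissible ω →
        ∃ g : C(Circle, A), WeightedWiener.HasACFS p ω g ∧ (∀ z, f z * g z = 1))) ∧
    -- two-sided inverses
    ((∀ z, IsUnit (f z)) →
      (∃ (ν : ℤ → ℝ) (g : C(Circle, A)), WeightedWiener.IsWeight ν ∧
        (∀ n, 1 ≤ ν n ∧ ν n ≤ ω n) ∧
        (WeightedWiener.IsConst ν ↔ WeightedWiener.IsConst ω) ∧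
        WeightedWiener.HasACFS p ν g ∧ (∀ z, g z * f z = 1 ∧ f z * g z = 1)) ∧
      (WeightedWiener.IsAdmissible ω →
        ∃ g : C(Circle, A), WeightedWiener.HasACFS p ω g ∧
          (∀ z, g z * f z = 1 ∧ f z * g z = 1))) := by
  refine ⟨fun h => ?_, fun h => ?_, fun h => ?_⟩
  · obtain ⟨g, R, hg, hR, hν⟩ := WeightedWiener.exists_leftInverse hp0 hp1 hω hf h
    obtain ⟨ν, hw, hle, hc, hC⟩ := hω.exists_slow_weight hR
    exact ⟨⟨ν, g, hw, hle, hc, hν ν hw (fun n => (hle n).2) hC, hg⟩,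
      fun ha => ⟨g, hν ω hω (fun _ => le_rfl) (ha.exists_growth hω hR), hg⟩⟩
  · obtain ⟨g, R, hg, hR, hν⟩ := WeightedWiener.exists_rightInverse hp0 hp1 hω hf h
    obtain ⟨ν, hw, hle, hc, hC⟩ := hω.exists_slow_weight hR
    exact ⟨⟨ν, g, hw, hle, hc, hν ν hw (fun n => (hle n).2) hC, hg⟩,
      fun ha => ⟨g, hν ω hω (fun _ => le_rfl) (ha.exists_growth hω hR), hg⟩⟩
  · obtain ⟨g, R, hg, hR, hν⟩ := WeightedWiener.exists_leftInverse hp0 hp1 hω hf fun z =>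
      (h z).exists_left_inv
    -- A left inverse of a unit is its inverse, so the left-sided construction suffices.
    have hg2 : ∀ z, g z * f z = 1 ∧ f z * g z = 1 := fun z => by
      obtain ⟨b, hb⟩ := (h z).exists_right_inv
      exact ⟨hg z, left_inv_eq_right_inv (hg z) hb ▸ hb⟩
    obtain ⟨ν, hw, hle, hc, hC⟩ := hω.exists_slow_weight hR
    exact ⟨⟨ν, g, hw, hle, hc, hν ν hw (fun n => (hle n).2) hC, hg2⟩,
      fun ha => ⟨g, hν ω hω (fun _ => le_rfl) (ha.exists_growth hω hR), hg2⟩⟩
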